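/- For a Hilbert space $\mathcal H$ and a unitary $U=(U_{ij})\in M_n(\mathcal B(\mathcal H))$ let $\mathfrak B_n(U)=\{I\}\cup\{U_{ij},U_{ij}^*\}_{i,j=1}^n$, regarded as a family of operators indexed by $2n^2+1$ labels. Let $UC_q(n,m)\subset\mathbb C^{(2n^2+1)(2m^2+1)}$ be the set of all families $(\langle (X\otimes Y)\psi,\psi\rangle)_{X\in\mathfrak B_n(U),\,Y\in\mathfrak B_m(V)}$, where $U\in M_n(\mathcal B(\mathcal H_A))$ and $V\in M_m(\mathcal B(\mathcal H_B))$ are unitary, $\mathcal H_A,\mathcal H_B$ are finite-dimensional Hilbert spaces and $\psi\in\mathcal H_A\otimes\mathcal H_B$ is a unit vector. Let $UC_{loc}(n,m)$ be the set of all families $(\langle XY\psi,\psi\rangle)_{X\in\mathfrak B_n(U),\,Y\in\mathfrak B_m(V)}$, where $U\in M_n(\mathcal B(\mathcal H))$ and $V\in M_m(\mathcal B(\mathcal H))$ are unitary, $\mathcal H$ is a Hilbert space, $\psi\in\mathcal H$ is a unit vector, $XY=YX$ for all $X\in\mathfrak B_n(U)$, $Y\in\mathfrak B_m(V)$, and the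 C*-algebra $C^*(\mathfrak B_n(U)\cup\mathfrak B_m(V))$ is commutative. Then for all $n,m\ge 2$, $$UC_{loc}(n,m)\subsetneq UC_q(n,m).$$ Moreover, strictness is witnessed by the maximally entangled vector in the following sense. Let $d=\min(n,m)$ and $\alpha=\frac1{\sqrt d}\sum_{i=1}^d e_i\otimes e_i=\sum_{i,k}\alpha_{ik}\,e_i\otimes e_k\in\mathbb C^n\otimes\mathbb C^m$. Its projective tensor norm, with respect to the Euclidean norms on $\mathbb C^n$ and $\mathbb C^m$, is $\|\alpha\|_\pi=\sqrt d>1$. There is a point of the closure $\overline{UC_q(n,m)}$ whose coordinate at $(U_{i1},V_{k1})$ is $\alpha_{ik}$ for all $1\le i\le n$, $1\le k\le m$, and no point of $\overline{UC_{loc}(n,m)}$ has these coordinates. -/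

import Mathlib

open scoped TensorProduct

universe u v

namespace UnitaryCorrelation

/-- The labels of the elements of `𝔅ₙ(U) = {I} ∪ {U i j, (U i j)*}`. There are `2 n ^ 2 + 1`. -/
inductive Label (n : ℕ) : Type
  | one : Label n
  | entry (i j : Fin n) : Label n
  | entryStar (i j : Fin n) : Label n

/-- The space `ℂ ^ ((2 n ^ 2 + 1) (2 m ^ 2 + 1))` of families of numbers `(c (X, Y))` with `X`
running over the labels of `𝔅ₙ(U)` and `Y` over those of `𝔅ₘ(V)`. It carries the usual
topology. -/
abbrev Correlation (n m : ℕ) : Type := Label n → Label m → ℂ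

noncomputable section

section Operators

variable {H : Type u} [NormedAddCommGroup H] [InnerProductSpace ℂ H] [CompleteSpace H]

/-- The family `𝔅ₙ(U)` of bounded operators: the identity, the entries of `U` and their
adjoints. -/
def genOp {n : ℕ} (U : Matrix (Fin n) (Fin n) (H →L[ℂ] H)) : Label n → (H →L[ℂ] H)
  | .one => 1
  | .entry i j => U i j
  | .entryStar i j => star (U i j)

/-- The unital C*-subalgebra of `B(H)` generated by a set of operators: the norm closure of the
unital *-algebra that the set generates. -/
def cstarGenerated (S : Set (H →L[ℂ] H)) : StarSubalgebra ℂ (H →L[ℂ] H) :=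
  (StarAlgebra.adjoin ℂ S).topologicalClosure

end Operators

/-- `UC_loc(n, m)`: the correlations `⟨X Y ψ, ψ⟩` (`X ∈ 𝔅ₙ(U)`, `Y ∈ 𝔅ₘ(V)`) of the commuting model
on a Hilbert space `H` for which `C*(𝔅ₙ(U) ∪ 𝔅ₘ(V))` is commutative. Mathlib's inner product
is linear in the second variable, so `⟨T ψ, ψ⟩` is `inner ℂ ψ (T ψ)`. -/
def UCloc (n m : ℕ) : Set (Correlation n m) :=
  {c | ∃ (H : Type u) (_ : NormedAddCommGroup H) (_ : InnerProductSpace ℂ H)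
      (_ : CompleteSpace H)
      (U : Matrix (Fin n) (Fin n) (H →L[ℂ] H)) (V : Matrix (Fin m) (Fin m) (H →L[ℂ] H)) (ψ : H),
      U ∈ unitary (Matrix (Fin n) (Fin n) (H →L[ℂ] H)) ∧
      V ∈ unitary (Matrix (Fin m) (Fin m) (H →L[ℂ] H)) ∧
      ‖ψ‖ = 1 ∧
      (∀ x y, genOp U x * genOp V y = genOp V y * genOp U x) ∧
      (∀ a ∈ cstarGenerated (Set.range (genOp U) ∪ Set.range (genOp V)),
        ∀ b ∈ cstarGenerated (Set.range (genOp U) ∪ Set.range (genOp V)), a * b = b * a) ∧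
      ∀ x y, c x y = inner ℂ ψ ((genOp U x * genOp V y) ψ)}

/-- `UC_q(n, m)`: the correlations `⟨(X ⊗ Y) ψ, ψ⟩` (`X ∈ 𝔅ₙ(U)`, `Y ∈ 𝔅ₘ(V)`) with unitary
`U ∈ Mₙ(B(H_A))`, `V ∈ Mₘ(B(H_B))` over finite-dimensional Hilbert spaces and a unit
vector `ψ ∈ H_A ⊗ H_B`. -/
def UCq (n m : ℕ) : Set (Correlation n m) :=
  {c | ∃ (HA : Type v) (_ : NormedAddCommGroup HA) (_ : InnerProductSpace ℂ HA)
      (_ : CompleteSpace HA) (_ : FiniteDimensional ℂ HA)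
      (HB : Type v) (_ : NormedAddCommGroup HB) (_ : InnerProductSpace ℂ HB)
      (_ : CompleteSpace HB) (_ : FiniteDimensional ℂ HB)
      (U : Matrix (Fin n) (Fin n) (HA →L[ℂ] HA)) (V : Matrix (Fin m) (Fin m) (HB →L[ℂ] HB))
      (ψ : HA ⊗[ℂ] HB),
      U ∈ unitary (Matrix (Fin n) (Fin n) (HA →L[ℂ] HA)) ∧
      V ∈ unitary (Matrix (Fin m) (Fin m) (HB →L[ℂ] HB)) ∧
      ‖ψ‖ = 1 ∧
      ∀ x y, c x y = inner ℂ ψ (TensorProduct.mapL (genOp U x) (genOp V y) ψ)}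

/-- The projective tensor norm: the infimum of `∑ ‖x i‖ ‖y i‖` over all representations
`t = ∑ x i ⊗ y i` as a finite sum. -/
def projectiveNorm {E : Type u} {F : Type v} [NormedAddCommGroup E] [NormedSpace ℂ E]
    [NormedAddCommGroup F] [NormedSpace ℂ F] (t : E ⊗[ℂ] F) : ℝ :=
  sInf {r : ℝ | ∃ (k : ℕ) (x : Fin k → E) (y : Fin k → F),
    t = ∑ i, x i ⊗ₜ[ℂ] y i ∧ r = ∑ i, ‖x i‖ * ‖y i‖}

/-- The coefficients of the maximally entangled vector: with `d = min n m`, the `(i, k)` entry is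
`1 / √d` if `i = k` and `0` otherwise. -/
def maxEntangledCoeff (n m : ℕ) (i : Fin n) (k : Fin m) : ℂ :=
  if (i : ℕ) = (k : ℕ) then ((1 / √((min n m : ℕ) : ℝ) : ℝ) : ℂ) else 0

/-- The maximally entangled vector `(1 / √d) ∑_{i < d} e_i ⊗ e_i` of `ℂⁿ ⊗ ℂᵐ`,
where `d = min n m`. -/
def maxEntangled (n m : ℕ) : EuclideanSpace ℂ (Fin n) ⊗[ℂ] EuclideanSpace ℂ (Fin m) :=
  ∑ i : Fin n, ∑ k : Fin m, maxEntangledCoeff n m i k •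
    (EuclideanSpace.single i (1 : ℂ) ⊗ₜ[ℂ] EuclideanSpace.single k (1 : ℂ))

/-- The correlations whose entries at the pairs `(u i 1, v k 1)` of first-column entries are the
coefficients of the maximally entangled vector. -/
def EmbezzlesMaxEntangled {n m : ℕ} (c : Correlation n m) : Prop :=
  ∀ (i j : Fin n) (k l : Fin m), (j : ℕ) = 0 → (l : ℕ) = 0 →
    c (.entry i j) (.entry k l) = maxEntangledCoeff n m i k

end

end UnitaryCorrelation

namespace UnitaryCorrelation

/-! Everything is compared with the convex hull K of the correlations coming from scalar unitaries.
K is compact, contains `UCloc` and is contained in `UCq`. A commutative C*-algebra is seen through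
its characters, which turn U and V into scalar unitaries; a state lies in the closed convex hull of
the characters, so its correlations lie in K (`mem_convexHull_of_state`). Conversely, a finite
average of product correlations is realised by direct sums of scalar unitaries and a
Schmidt-diagonal vector (`convexHull_subset_UCq`). On K the real part of the sum of the coordinates
at (u i 0, v i 0), i < d, is at most 1, by Cauchy–Schwarz for unit columns. The maximally entangled
coefficients sum to √d > 1. Since K is closed, they are excluded from the closure of `UCloc`. They
are reached in the closure of `UCq` by embezzlement. Put Schmidt weights on a finite d-ary tree so
that the d children of a vertex share its squared weight equally. Permutation unitaries whose first
columns send each child to its parent, recording which child it was, reproduce the coefficients up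
to an error of order 1 / (total mass), and the mass can be made arbitrarily large
(`exists_mem_UCq_norm_sub_le`). Compactness gives an exact limit point. The projective norm is √d by
duality with the bilinear form ∑ x i * y i. -/

instance (n : ℕ) : Finite (Label n) :=
  Finite.of_injective
    (fun x : Label n => (match x with
      | .one => none
      | .entry i j => some (i, j, true)
      | .entryStar i j => some (i, j, false) : Option (Fin n × Fin n × Bool)))
    (by rintro (_ | _ | _) (_ | _ | _) h <;> simp_all)

noncomputable instance (n : ℕ) : Fintype (Label n) := Fintype.ofFinite _

/-! ### Generating families and unitarity under *-homomorphisms -/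

section GeneratingFamily

variable {A B : Type*}

/-- The identity, the entries of `U` and their adjoints, in an arbitrary ring with a star. -/
def genElt [One A] [Star A] {n : ℕ} (U : Matrix (Fin n) (Fin n) A) : Label n → A
  | .one => 1
  | .entry i j => U i j
  | .entryStar i j => star (U i j)

lemma genOp_eq_genElt {H : Type*} [NormedAddCommGroup H] [InnerProductSpace ℂ H]
    [CompleteSpace H] {n : ℕ} (U : Matrix (Fin n) (Fin n) (H →L[ℂ] H)) :
    genOp U = genElt U := by
  funext x; cases x <;> rfl

variable [Ring A] [StarRing A] [Ring B] [StarRing B] {F : Type*} [FunLike F A B]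
  [RingHomClass F A B] [StarHomClass F A B] {n : ℕ}

/-- Used for three kinds of *-homomorphism: characters, the inclusion of a *-subalgebra into the
bounded operators, and `Matrix.toEuclideanCLM`. -/
lemma map_genElt (φ : F) (U : Matrix (Fin n) (Fin n) A) (x : Label n) :
    φ (genElt U x) = genElt (U.map φ) x := by
  cases x <;> simp [genElt, map_star]

lemma map_star_mul_self (φ : F) (U : Matrix (Fin n) (Fin n) A) :
    star (U.map φ) * U.map φ = (star U * U).map φ ∧
      U.map φ * star (U.map φ) = (U * star U).map φ := by
  constructor <;>
  · ext i j
    simp [Matrix.mul_apply, Matrix.star_apply, map_star]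

lemma map_mem_unitary (φ : F) {U : Matrix (Fin n) (Fin n) A}
    (hU : U ∈ unitary (Matrix (Fin n) (Fin n) A)) :
    U.map φ ∈ unitary (Matrix (Fin n) (Fin n) B) := by
  rw [Unitary.mem_iff] at hU ⊢
  rw [(map_star_mul_self φ U).1, (map_star_mul_self φ U).2, hU.1, hU.2,
    Matrix.map_one φ (map_zero φ) (map_one φ)]
  exact ⟨rfl, rfl⟩

lemma mem_unitary_of_map (φ : F) (hφ : Function.Injective φ) {U : Matrix (Fin n) (Fin n) A}
    (hU : U.map φ ∈ unitary (Matrix (Fin n) (Fin n) B)) :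
    U ∈ unitary (Matrix (Fin n) (Fin n) A) := by
  rw [Unitary.mem_iff] at hU ⊢
  rw [(map_star_mul_self φ U).1, (map_star_mul_self φ U).2,
    ← Matrix.map_one φ (map_zero φ) (map_one φ)] at hU
  exact ⟨Matrix.map_injective hφ hU.1, Matrix.map_injective hφ hU.2⟩

end GeneratingFamily

/-! ### Compactness of convex hulls in finite dimension -/

section ConvexHull

variable {E : Type*} [AddCommGroup E] [Module ℝ E] [TopologicalSpace E] [ContinuousAdd E]
  [ContinuousSMul ℝ E]

/-- In a finite-dimensional space the convex hull of a compact set is compact. -/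
lemma isCompact_convexHull [FiniteDimensional ℝ E] {K : Set E} (hK : IsCompact K) :
    IsCompact (convexHull ℝ K) := by
  classical
  rcases K.eq_empty_or_nonempty with rfl | ⟨e, he⟩
  · simp
  -- Carathéodory's bound: N points always suffice. Shorter combinations are padded with weight 0 at
  -- the point `e`, so the hull is the image of one compact set.
  let N := Module.finrank ℝ E + 1
  let comb : (Fin N → ℝ) × (Fin N → E) → E := fun p => ∑ i, p.1 i • p.2 i
  have hcomb : Continuous comb := by
    simp only [comb]
    fun_prop
  have key : convexHull ℝ K =
      comb '' (stdSimplex ℝ (Fin N) ×ˢ Set.univ.pi fun _ => K) := by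
    apply Set.Subset.antisymm
    · intro x hx
      obtain ⟨ι, _, z, w, hz, hind, hw, hsum, rfl⟩ := eq_pos_convex_span_of_mem_convexHull hx
      have hcard : Fintype.card ι ≤ Fintype.card (Fin N) := by
        simpa [N] using hind.card_le_finrank_succ.trans
          (Nat.add_le_add_right (Submodule.finrank_le _) 1)
      obtain ⟨g⟩ := Function.Embedding.nonempty_of_card_le hcard
      have hext (i : Fin N) (hi : i ∉ Set.range g) : Function.extend g w 0 i = 0 :=
        Function.extend_apply' _ _ _ hi
      refine ⟨(Function.extend g w 0, Function.extend g z fun _ => e), ⟨⟨fun i => ?_, ?_⟩, ?_⟩, ?_⟩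
      · by_cases hi : ∃ a, g a = i
        · obtain ⟨a, rfl⟩ := hi
          simpa only [g.injective.extend_apply] using (hw a).le
        · exact (hext i hi).ge
      · rw [← hsum]
        refine (Fintype.sum_of_injective g g.injective _ _ hext fun i => ?_).symm
        rw [g.injective.extend_apply]
      · intro i _
        by_cases hi : ∃ a, g a = i
        · obtain ⟨a, rfl⟩ := hi
          simp only [g.injective.extend_apply]
          exact hz ⟨a, rfl⟩
        · simpa only [Function.extend_apply' _ _ _ hi] using he
      · refine (Fintype.sum_of_injective g g.injective _ _ (fun i hi => ?_) fun i => ?_).symm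
        · simp only [hext i hi, zero_smul]
        · simp only [g.injective.extend_apply]
    · rintro _ ⟨⟨w, z⟩, ⟨hw, hz⟩, rfl⟩
      exact mem_convexHull_of_exists_fintype w z hw.1 hw.2 (fun i => hz i trivial) rfl
  rw [key]
  exact ((isCompact_stdSimplex ℝ (Fin N)).prod (isCompact_univ_pi fun _ => hK)).image hcomb

end ConvexHull

/-! ### Correlations of scalar unitaries -/

section Product

/-- The correlations `u x * v y` of scalar unitary matrices `u` and `v`. -/
def productCorrelations (n m : ℕ) : Set (Correlation n m) :=
  {c | ∃ u ∈ unitary (Matrix (Fin n) (Fin n) ℂ), ∃ v ∈ unitary (Matrix (Fin m) (Fin m) ℂ),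
    ∀ x y, c x y = genElt u x * genElt v y}

lemma isCompact_unitary_matrix (n : ℕ) :
    IsCompact (unitary (Matrix (Fin n) (Fin n) ℂ) : Set (Matrix (Fin n) (Fin n) ℂ)) := by
  have hc : IsCompact (Set.univ.pi fun _ : Fin n => Set.univ.pi fun _ : Fin n =>
      Metric.closedBall (0 : ℂ) 1) :=
    isCompact_univ_pi fun _ => isCompact_univ_pi fun _ => isCompact_closedBall 0 1
  refine hc.of_isClosed_subset ?_ ?_
  · have : (unitary (Matrix (Fin n) (Fin n) ℂ) : Set (Matrix (Fin n) (Fin n) ℂ)) =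
        {U | star U * U = 1} ∩ {U | U * star U = 1} := by
      ext U
      exact Unitary.mem_iff
    rw [this]
    exact (isClosed_eq (by fun_prop) continuous_const).inter
      (isClosed_eq (by fun_prop) continuous_const)
  · intro U hU i _ j _
    rw [mem_closedBall_zero_iff]
    exact entry_norm_bound_of_unitary hU i j

lemma continuous_genElt {n : ℕ} (x : Label n) :
    Continuous fun u : Matrix (Fin n) (Fin n) ℂ => genElt u x := by
  cases x <;> simp only [genElt] <;> fun_prop

/-- Compactness is needed only for closedness: it permits strict separation by a functional, and it
keeps limits of points of `UCloc` inside the hull. -/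
lemma isCompact_convexHull_productCorrelations (n m : ℕ) :
    IsCompact (convexHull ℝ (productCorrelations n m)) := by
  refine isCompact_convexHull ?_
  have h : productCorrelations n m =
      (fun p : Matrix (Fin n) (Fin n) ℂ × Matrix (Fin m) (Fin m) ℂ =>
        (fun x y => genElt p.1 x * genElt p.2 y : Correlation n m)) ''
      ((unitary (Matrix (Fin n) (Fin n) ℂ) : Set (Matrix (Fin n) (Fin n) ℂ)) ×ˢ
        (unitary (Matrix (Fin m) (Fin m) ℂ) : Set (Matrix (Fin m) (Fin m) ℂ))) := by
    ext c
    constructor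
    · rintro ⟨u, hu, v, hv, h⟩
      exact ⟨(u, v), ⟨hu, hv⟩, by funext x y; exact (h x y).symm⟩
    · rintro ⟨⟨u, v⟩, ⟨hu, hv⟩, rfl⟩
      exact ⟨u, hu, v, hv, fun _ _ => rfl⟩
  rw [h]
  refine ((isCompact_unitary_matrix n).prod (isCompact_unitary_matrix m)).image ?_
  refine continuous_pi fun x => continuous_pi fun y => ?_
  exact ((continuous_genElt x).comp continuous_fst).mul ((continuous_genElt y).comp continuous_snd)

end Product

/-! ### States on commutative C*-algebras and the local model -/

section Gelfand

open WeakDual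

open scoped Classical in
lemma apply_eq_sum_single {n m : ℕ} (f : StrongDual ℂ (Correlation n m)) (c : Correlation n m) :
    f c = ∑ x, ∑ y, c x y * f (Pi.single x (Pi.single y 1)) := by
  have h : c = ∑ x, ∑ y, c x y • (Pi.single x (Pi.single y 1) : Correlation n m) := by
    funext x y
    simp [Finset.sum_apply, Pi.single_apply, ite_apply]
  conv_lhs => rw [h]
  simp only [map_sum, map_smul, smul_eq_mul]

/-- A state on a commutative C*-algebra is an average of characters, hence its correlations are
averages of product correlations. -/
lemma mem_convexHull_of_state {A : Type*} [CommCStarAlgebra A] (ω : A →ₗ[ℂ] ℂ)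
    (hpos : ∀ a, 0 ≤ (ω (star a * a)).re) (hstar : ∀ a, ω (star a) = star (ω a))
    (hone : ω 1 = 1) {n m : ℕ} {U : Matrix (Fin n) (Fin n) A} {V : Matrix (Fin m) (Fin m) A}
    (hU : U ∈ unitary (Matrix (Fin n) (Fin n) A)) (hV : V ∈ unitary (Matrix (Fin m) (Fin m) A))
    {c : Correlation n m} (hc : ∀ x y, c x y = ω (genElt U x * genElt V y)) :
    c ∈ convexHull ℝ (productCorrelations n m) := by
  classical
  by_contra hnot
  obtain ⟨f, s, hlt, hgt⟩ := RCLike.geometric_hahn_banach_closed_point (𝕜 := ℂ)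
    (convex_convexHull ℝ (productCorrelations n m))
    (isCompact_convexHull_productCorrelations n m).isClosed hnot
  -- `T` encodes the separating functional `f` in the algebra: a state takes on `T` the value of `f`
  -- at its correlations. Characters thus give real part at most `s`, while `ω` would exceed `s`.
  let T : A := ∑ x, ∑ y, f (Pi.single x (Pi.single y 1)) • (genElt U x * genElt V y)
  have hωT : ω T = f c := by
    rw [apply_eq_sum_single f c]
    simp [T, map_sum, hc, mul_comm]
  have hchar (φ : characterSpace ℂ A) : (φ T).re ≤ s := by
    let k : Correlation n m := fun x y => genElt (U.map φ) x * genElt (V.map φ) y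
    have hk : φ T = f k := by
      rw [apply_eq_sum_single f k]
      simp [T, map_sum, k, ← map_genElt, mul_comm]
    rw [hk]
    exact (hlt k (subset_convexHull ℝ _
      ⟨_, map_mem_unitary φ hU, _, map_mem_unitary φ hV, fun _ _ => rfl⟩)).le
  -- The square root of s - Re T on the character space; it exhibits s - Re T as b* b, on which `ω`
  -- is nonnegative.
  let b : C(characterSpace ℂ A, ℂ) :=
    ⟨fun φ => ((√(s - (gelfandStarTransform A T φ).re) : ℝ) : ℂ), by fun_prop⟩
  have hb : star b * b =
      gelfandStarTransform A ((s : ℂ) • 1 - (1 / 2 : ℂ) • (T + star T)) := by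
    ext φ
    have h0 : 0 ≤ s - (φ T).re := sub_nonneg.2 (hchar φ)
    have h1 : ((√(s - (φ T).re) : ℝ) : ℂ) * ((√(s - (φ T).re) : ℝ) : ℂ) = s - (φ T).re := by
      rw [← Complex.ofReal_mul, Real.mul_self_sqrt h0, Complex.ofReal_sub]
    simp only [b, ContinuousMap.mul_apply, ContinuousMap.star_apply, ContinuousMap.coe_mk,
      gelfandStarTransform_apply_apply, Complex.star_def, Complex.conj_ofReal, h1, map_sub,
      map_smul, map_add, map_one, map_star]
    simp only [ContinuousMap.sub_apply, ContinuousMap.smul_apply, ContinuousMap.add_apply,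
      ContinuousMap.one_apply, ContinuousMap.star_apply, gelfandStarTransform_apply_apply,
      Complex.star_def, Complex.add_conj, smul_eq_mul]
    push_cast
    ring
  have hp := hpos ((gelfandStarTransform A).symm b)
  rw [← map_star, ← map_mul, hb, StarAlgEquiv.symm_apply_apply, map_sub, map_smul, map_smul,
    map_add, hstar, hone, hωT] at hp
  have : (f c).re ≤ s := by
    simp at hp
    linarith
  exact absurd hgt (not_lt.2 this)

end Gelfand
-- The generated algebra is a commutative C*-algebra on which the vector functional of `ψ` is a
-- state. `U` and `V` are already unitary over it, because its inclusion into the bounded operators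
-- is injective.
lemma UCloc_subset_convexHull (n m : ℕ) :
    UCloc.{u} n m ⊆ convexHull ℝ (productCorrelations n m) := by
  rintro c ⟨H, _, _, _, U, V, ψ, hU, hV, hψ, -, hcomm, hc⟩
  let S := cstarGenerated (Set.range (genOp U) ∪ Set.range (genOp V))
  have hS (x) (hx : x ∈ Set.range (genOp U) ∪ Set.range (genOp V)) : x ∈ S :=
    (StarAlgebra.adjoin ℂ _).le_topologicalClosure (StarAlgebra.subset_adjoin ℂ _ hx)
  have : IsClosed (S : Set (H →L[ℂ] H)) := StarSubalgebra.isClosed_topologicalClosure _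
  let _ : CommCStarAlgebra S :=
    { StarSubalgebra.cstarAlgebra S with
      mul_comm := fun a b => Subtype.ext (hcomm a a.2 b b.2) }
  let ω : S →ₗ[ℂ] ℂ :=
    { toFun := fun a => inner ℂ ψ ((a : H →L[ℂ] H) ψ)
      map_add' := fun a b => by simp
      map_smul' := fun r a => by simp }
  let U' : Matrix (Fin n) (Fin n) S := fun i j => ⟨U i j, hS _ (Or.inl ⟨.entry i j, rfl⟩)⟩
  let V' : Matrix (Fin m) (Fin m) S := fun i j => ⟨V i j, hS _ (Or.inr ⟨.entry i j, rfl⟩)⟩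
  refine mem_convexHull_of_state ω (U := U') (V := V') ?_ ?_ ?_
    (mem_unitary_of_map S.subtype Subtype.val_injective hU)
    (mem_unitary_of_map S.subtype Subtype.val_injective hV) ?_
  · intro a
    simp only [ω, LinearMap.coe_mk, AddHom.coe_mk]
    have : ((star a * a : S) : H →L[ℂ] H) ψ = star (a : H →L[ℂ] H) ((a : H →L[ℂ] H) ψ) := rfl
    rw [this, ContinuousLinearMap.star_eq_adjoint, ContinuousLinearMap.adjoint_inner_right]
    exact inner_self_nonneg (𝕜 := ℂ)
  · intro a
    simp only [ω, LinearMap.coe_mk, AddHom.coe_mk]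
    have : ((star a : S) : H →L[ℂ] H) = star (a : H →L[ℂ] H) := rfl
    rw [this, ContinuousLinearMap.star_eq_adjoint, ContinuousLinearMap.adjoint_inner_right]
    exact (inner_conj_symm _ _).symm
  · have : ((1 : S) : H →L[ℂ] H) ψ = ψ := rfl
    simp only [ω, LinearMap.coe_mk, AddHom.coe_mk, this]
    simp [inner_self_eq_norm_sq_to_K, hψ]
  · intro x y
    have hx : genOp U x = S.subtype (genElt U' x) := by
      rw [map_genElt, genOp_eq_genElt]; rfl
    have hy : genOp V y = S.subtype (genElt V' y) := by
      rw [map_genElt, genOp_eq_genElt]; rfl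
    rw [hc, hx, hy]
    rfl

/-- By the Cauchy–Schwarz inequality the entries at `(u i 0, v i 0)` of a product correlation have
a sum of modulus at most `1`, which the maximally entangled vector violates. -/
lemma not_embezzles_of_mem_convexHull {n m : ℕ} (hn : 2 ≤ n) (hm : 2 ≤ m) {c : Correlation n m}
    (hc : c ∈ convexHull ℝ (productCorrelations n m)) : ¬ EmbezzlesMaxEntangled c := by
  intro he
  let j : Fin n := ⟨0, by omega⟩
  let l : Fin m := ⟨0, by omega⟩
  let a : Fin (min n m) → Fin n := Fin.castLE (min_le_left n m)
  let b : Fin (min n m) → Fin m := Fin.castLE (min_le_right n m)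
  -- A half-space is convex, so its inequality need only be checked on product correlations.
  have hhalf : Convex ℝ {c : Correlation n m |
      (∑ i, c (.entry (a i) j) (.entry (b i) l)).re ≤ 1} := by
    refine convex_halfSpace_le ⟨fun c d => ?_, fun r c => ?_⟩ 1
    · simp [Finset.sum_add_distrib]
    · simp [Finset.mul_sum]
  have hsub := convexHull_min (s := productCorrelations n m) (fun c hc => ?_) hhalf
  · have h := hsub hc
    have hval (i) : c (.entry (a i) j) (.entry (b i) l) =
        ((1 / √((min n m : ℕ) : ℝ) : ℝ) : ℂ) := by
      rw [he _ _ _ _ rfl rfl]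
      simp [maxEntangledCoeff, a, b]
    simp only [Set.mem_ofPred_eq, hval, Finset.sum_const, Finset.card_univ, Fintype.card_fin,
      nsmul_eq_mul] at h
    rw [← Complex.ofReal_natCast, ← Complex.ofReal_mul, Complex.ofReal_re, mul_one_div,
      Real.div_sqrt] at h
    have : (2 : ℝ) ≤ (min n m : ℕ) := by exact_mod_cast le_min hn hm
    have h2 : 1 < √((min n m : ℕ) : ℝ) := Real.lt_sqrt_of_sq_lt (by linarith)
    linarith
  · obtain ⟨u, hu, v, hv, hc⟩ := hc
    have hcol {k : ℕ} {w : Matrix (Fin k) (Fin k) ℂ} (hw : w ∈ unitary (Matrix (Fin k) (Fin k) ℂ))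
        (j : Fin k) {ι : Type} [Fintype ι] (a : ι → Fin k) (ha : a.Injective) :
        ∑ i, ‖w (a i) j‖ ^ 2 ≤ 1 := by
      have h1 : ∑ i, ‖w i j‖ ^ 2 = 1 := by
        have := congr_fun₂ (Unitary.mem_iff.1 hw).1 j j
        rw [Matrix.mul_apply, Matrix.one_apply_eq] at this
        simp only [Matrix.star_apply, Complex.star_def, Complex.conj_mul'] at this
        exact_mod_cast this
      rw [← h1, ← Finset.sum_image (f := fun i => ‖w i j‖ ^ 2) ha.injOn]
      exact Finset.sum_le_univ_sum_of_nonneg fun _ => by positivity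
    have hu' := hcol hu j a (Fin.castLE_injective _)
    have hv' := hcol hv l b (Fin.castLE_injective _)
    refine (Complex.re_le_norm _).trans ((norm_sum_le _ _).trans ?_)
    calc ∑ i, ‖c (.entry (a i) j) (.entry (b i) l)‖
        ≤ ∑ i, (‖u (a i) j‖ ^ 2 + ‖v (b i) l‖ ^ 2) / 2 := by
          refine Finset.sum_le_sum fun i _ => ?_
          rw [hc, norm_mul]
          simp only [genElt]
          -- The arithmetic–geometric mean inequality is enough, as both column sums of squares are
          -- at most 1.
          linarith [two_mul_le_add_sq ‖u (a i) j‖ ‖v (b i) l‖]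
      _ ≤ 1 := by
          rw [← Finset.sum_div, Finset.sum_add_distrib]
          linarith

/-! ### Schmidt-diagonal vectors and direct sums -/

section DiagonalState

variable {ι : Type v} [Fintype ι] [DecidableEq ι]

/-- The vector `∑ a, w a • (e a ⊗ e a)`. -/
noncomputable def diagVec (w : ι → ℝ) : EuclideanSpace ℂ ι ⊗[ℂ] EuclideanSpace ℂ ι :=
  ∑ a, (w a : ℂ) • (EuclideanSpace.single a (1 : ℂ) ⊗ₜ[ℂ] EuclideanSpace.single a (1 : ℂ))

lemma inner_single_toEuclideanCLM (M : Matrix ι ι ℂ) (a b : ι) :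
    inner ℂ (EuclideanSpace.single a (1 : ℂ))
      (Matrix.toEuclideanCLM (𝕜 := ℂ) M (EuclideanSpace.single b (1 : ℂ))) = M a b := by
  simp [EuclideanSpace.inner_single_left]

omit [DecidableEq ι] in
lemma inner_sum_tmul_mapL {E F : Type*} [NormedAddCommGroup E] [InnerProductSpace ℂ E]
    [NormedAddCommGroup F] [InnerProductSpace ℂ F] (w : ι → ℂ) (e : ι → E) (f : ι → F)
    (X : E →L[ℂ] E) (Y : F →L[ℂ] F) :
    inner ℂ (∑ a, w a • (e a ⊗ₜ[ℂ] f a))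
      (TensorProduct.mapL X Y (∑ a, w a • (e a ⊗ₜ[ℂ] f a))) =
    ∑ a, ∑ b, star (w a) * w b * (inner ℂ (e a) (X (e b)) * inner ℂ (f a) (Y (f b))) := by
  simp only [map_sum, map_smul, sum_inner, inner_sum, TensorProduct.mapL_tmul]
  rw [Finset.sum_comm]
  refine Finset.sum_congr rfl fun a _ => Finset.sum_congr rfl fun b _ => ?_
  rw [TensorProduct.smul_tmul', TensorProduct.smul_tmul', TensorProduct.inner_tmul,
    inner_smul_left, inner_smul_right, starRingEnd_apply]
  ring

/-- Against a Schmidt-diagonal vector, M ⊗ N acts through the entrywise product of M and N. This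
reduces both constructions in `UCq` to finite sums of matrix entries. -/
lemma inner_diagVec_mapL (w : ι → ℝ) (M N : Matrix ι ι ℂ) :
    inner ℂ (diagVec w) (TensorProduct.mapL (Matrix.toEuclideanCLM (𝕜 := ℂ) M)
      (Matrix.toEuclideanCLM (𝕜 := ℂ) N) (diagVec w)) =
    ∑ a, ∑ b, (w a : ℂ) * w b * (M a b * N a b) := by
  refine (inner_sum_tmul_mapL _ _ _ _ _).trans ?_
  simp only [inner_single_toEuclideanCLM, Complex.star_def, Complex.conj_ofReal]

lemma norm_diagVec {w : ι → ℝ} (hw : ∑ a, w a ^ 2 = 1) : ‖diagVec w‖ = 1 := by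
  have h : inner ℂ (diagVec w) (diagVec w) = 1 := by
    have := inner_diagVec_mapL w 1 1
    simp only [map_one] at this
    rw [show TensorProduct.mapL (1 : EuclideanSpace ℂ ι →L[ℂ] EuclideanSpace ℂ ι)
      (1 : EuclideanSpace ℂ ι →L[ℂ] EuclideanSpace ℂ ι) = 1 from TensorProduct.mapL_id_id] at this
    rw [one_apply_eq_self] at this
    rw [this]
    simp only [Matrix.one_apply, mul_ite, mul_one, mul_zero, Finset.sum_ite_eq,
      Finset.mem_univ, if_true]
    have hw' : ∑ a, (w a : ℂ) ^ 2 = 1 := by exact_mod_cast hw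
    simpa [sq] using hw'
  rw [inner_self_eq_norm_sq_to_K (𝕜 := ℂ) (diagVec w)] at h
  have h' : ‖diagVec w‖ ^ 2 = 1 := Complex.ofReal_injective (by simpa using h)
  exact (pow_eq_one_iff_of_nonneg (norm_nonneg _) two_ne_zero).1 h'

/-- The correlations of a diagonal state and unitaries with matrix entries belong to `UCq`. -/
lemma mem_UCq_of_diagVec {n m : ℕ} {w : ι → ℝ} (hw : ∑ a, w a ^ 2 = 1)
    {U : Matrix (Fin n) (Fin n) (Matrix ι ι ℂ)} {V : Matrix (Fin m) (Fin m) (Matrix ι ι ℂ)}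
    (hU : U ∈ unitary (Matrix (Fin n) (Fin n) (Matrix ι ι ℂ)))
    (hV : V ∈ unitary (Matrix (Fin m) (Fin m) (Matrix ι ι ℂ))) :
    (fun x y => ∑ a, ∑ b, (w a : ℂ) * w b * (genElt U x a b * genElt V y a b) :
      Correlation n m) ∈ UCq.{v} n m := by
  refine ⟨EuclideanSpace ℂ ι, inferInstance, inferInstance, inferInstance, inferInstance,
    EuclideanSpace ℂ ι, inferInstance, inferInstance, inferInstance, inferInstance,
    U.map (Matrix.toEuclideanCLM (𝕜 := ℂ)), V.map (Matrix.toEuclideanCLM (𝕜 := ℂ)), diagVec w,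
    map_mem_unitary _ hU, map_mem_unitary _ hV, norm_diagVec hw, fun x y => ?_⟩
  rw [genOp_eq_genElt, genOp_eq_genElt, ← map_genElt, ← map_genElt, inner_diagVec_mapL]

/-- The direct sum of a family of scalar matrices. -/
def directSum {n : ℕ} (u : ι → Matrix (Fin n) (Fin n) ℂ) : Matrix (Fin n) (Fin n) (Matrix ι ι ℂ) :=
  fun i j => Matrix.diagonal fun a => u a i j

omit [Fintype ι] in
lemma genElt_directSum {n : ℕ} (u : ι → Matrix (Fin n) (Fin n) ℂ) (x : Label n) :
    genElt (directSum u) x = Matrix.diagonal fun a => genElt (u a) x := by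
  cases x with
  | one => simp [genElt]
  | entry i j => rfl
  | entryStar i j =>
    simp only [genElt, directSum, Matrix.star_eq_conjTranspose, Matrix.diagonal_conjTranspose]
    rfl

lemma directSum_mem_unitary {n : ℕ} {u : ι → Matrix (Fin n) (Fin n) ℂ}
    (hu : ∀ a, u a ∈ unitary (Matrix (Fin n) (Fin n) ℂ)) :
    directSum u ∈ unitary (Matrix (Fin n) (Fin n) (Matrix ι ι ℂ)) := by
  have hstar : star (directSum u) = directSum fun a => star (u a) := by
    ext i j a b
    by_cases h : a = b
    · simp [directSum, Matrix.star_apply, h]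
    · simp [directSum, Matrix.star_apply, h, Ne.symm h]
  have hmul (p q : ι → Matrix (Fin n) (Fin n) ℂ) :
      directSum p * directSum q = directSum fun a => p a * q a := by
    ext i j a b
    simp only [directSum, Matrix.mul_apply, Matrix.sum_apply, Matrix.diagonal_mul_diagonal,
      Matrix.diagonal_apply]
    split_ifs <;> simp
  have hone : directSum (fun _ : ι => (1 : Matrix (Fin n) (Fin n) ℂ)) = 1 := by
    ext i j a b
    by_cases h : i = j <;> by_cases h' : a = b <;> 
      simp [directSum, Matrix.one_apply, h, h']
  have h (a) := Unitary.mem_iff.1 (hu a)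
  rw [Unitary.mem_iff, hstar, hmul, hmul]
  simp only [(h _).1, (h _).2, hone, and_self]

end DiagonalState

/-- With Schmidt weights √p and block-diagonal unitaries only the terms a = b survive, each with
weight p a: the shared diagonal state acts as classical shared randomness. -/
lemma convexHull_subset_UCq (n m : ℕ) :
    convexHull ℝ (productCorrelations n m) ⊆ UCq.{v} n m := by
  classical
  intro c hc
  obtain ⟨κ, _, p, z, hp, hsum, hz, rfl⟩ := mem_convexHull_iff_exists_fintype.1 hc
  choose u hu v hv h using hz
  have key := mem_UCq_of_diagVec (ι := ULift.{v} κ) (w := fun a => √(p a.down)) ?_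
    (directSum_mem_unitary fun a => hu a.down) (directSum_mem_unitary fun a => hv a.down)
  · convert key using 1
    funext x y
    simp only [genElt_directSum, Matrix.diagonal_apply, mul_ite, mul_zero, ite_mul, zero_mul,
      Finset.sum_apply, Pi.smul_apply, h]
    refine Fintype.sum_equiv Equiv.ulift.symm _ _ fun i => ?_
    rw [Finset.sum_eq_single (Equiv.ulift.symm i) (fun b _ hb => by rw [if_neg hb.symm])
      (by simp), if_pos rfl, if_pos rfl, ← Complex.ofReal_mul, Real.mul_self_sqrt (hp _),
      Complex.real_smul]
    rfl
  · simp only [Real.sq_sqrt (hp _)]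
    rw [← hsum]
    exact Fintype.sum_equiv Equiv.ulift _ _ fun _ => rfl

/-! ### Unitaries from permutations -/

section PermutationUnitary

variable {ι : Type v} [Fintype ι] [DecidableEq ι] {n : ℕ}

/-- The unitary of a permutation of the basis `(j, b)` of `ℂⁿ ⊗ ℂ^ι`, as a matrix with matrix
entries. -/
def permUnitary (σ : Equiv.Perm (Fin n × ι)) : Matrix (Fin n) (Fin n) (Matrix ι ι ℂ) :=
  fun i j a b => if σ (j, b) = (i, a) then 1 else 0

lemma permUnitary_mem_unitary (σ : Equiv.Perm (Fin n × ι)) :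
    permUnitary σ ∈ unitary (Matrix (Fin n) (Fin n) (Matrix ι ι ℂ)) := by
  have hstar (σ : Equiv.Perm (Fin n × ι)) : star (permUnitary σ) = permUnitary σ⁻¹ := by
    ext i j a b
    have h : σ (i, a) = (j, b) ↔ σ⁻¹ (j, b) = (i, a) := by
      rw [Equiv.Perm.inv_eq_iff_eq, eq_comm]
    simp only [permUnitary, Matrix.star_apply, ← h]
    split_ifs <;> simp
  have hmul (σ : Equiv.Perm (Fin n × ι)) : permUnitary σ * permUnitary σ⁻¹ = 1 := by
    ext i j a b
    simp only [Matrix.mul_apply, Matrix.sum_apply, permUnitary, ← Fintype.sum_prod_type',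
      Prod.mk.eta]
    rw [Finset.sum_eq_single (σ⁻¹ (j, b)) (fun x _ hx => by rw [if_neg hx.symm, mul_zero])
      (by simp), show σ (σ⁻¹ (j, b)) = (j, b) from σ.apply_symm_apply _, if_pos rfl, mul_one]
    by_cases h : i = j <;> by_cases h' : a = b <;>
      simp [Matrix.one_apply, h, h', eq_comm]
  rw [Unitary.mem_iff, hstar]
  exact ⟨by simpa using hmul σ⁻¹, hmul σ⟩

end PermutationUnitary

/-! ### Boundedness of quantum correlations -/

section Bounded

variable {H : Type*} [NormedAddCommGroup H] [InnerProductSpace ℂ H] [CompleteSpace H]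

/-- Each column of `U` is an isometry, by the diagonal entries of U* U = 1, so each of its entries
is a contraction. -/
lemma norm_genOp_le {n : ℕ} {U : Matrix (Fin n) (Fin n) (H →L[ℂ] H)}
    (hU : U ∈ unitary (Matrix (Fin n) (Fin n) (H →L[ℂ] H))) (x : Label n) : ‖genOp U x‖ ≤ 1 := by
  have hent (i j) : ‖U i j‖ ≤ 1 := by
    refine ContinuousLinearMap.opNorm_le_bound _ zero_le_one fun ξ => ?_
    have h1 : ∑ k, ‖U k j ξ‖ ^ 2 = ‖ξ‖ ^ 2 := by
      have := congr_arg (fun T : H →L[ℂ] H => (inner ℂ ξ (T ξ) : ℂ))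
        (congr_fun₂ (Unitary.mem_iff.1 hU).1 j j)
      simp only [Matrix.mul_apply, Matrix.one_apply_eq, Matrix.star_apply,
        sum_apply, mul_apply_eq_comp, inner_sum,
        ContinuousLinearMap.star_eq_adjoint, ContinuousLinearMap.adjoint_inner_right,
        one_apply_eq_self, inner_self_eq_norm_sq_to_K] at this
      exact_mod_cast this
    rw [one_mul]
    refine le_of_sq_le_sq ?_ (norm_nonneg _)
    rw [← h1]
    exact Finset.single_le_sum (f := fun k => ‖U k j ξ‖ ^ 2) (fun _ _ => by positivity)
      (Finset.mem_univ i)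
  cases x with
  | one => exact ContinuousLinearMap.norm_id_le
  | entry i j => exact hent i j
  | entryStar i j => exact (norm_star _).trans_le (hent i j)

/-- Approximate embezzlement controls only the first-column coordinates; compactness makes the
remaining ones converge along a subsequence. -/
lemma isCompact_closure_UCq (n m : ℕ) : IsCompact (closure (UCq.{v} n m)) := by
  have hc : IsCompact (Set.univ.pi fun _ : Label n => Set.univ.pi fun _ : Label m =>
      Metric.closedBall (0 : ℂ) 1) :=
    isCompact_univ_pi fun _ => isCompact_univ_pi fun _ => isCompact_closedBall 0 1
  refine hc.of_isClosed_subset isClosed_closure (closure_minimal ?_ hc.isClosed)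
  rintro c ⟨HA, _, _, _, _, HB, _, _, _, _, U, V, ψ, hU, hV, hψ, h⟩ x - y -
  rw [mem_closedBall_zero_iff, h]
  have h1 := TensorProduct.norm_mapL_le (genOp U x) (genOp V y)
  have h2 := mul_le_one₀ (norm_genOp_le hU x) (norm_nonneg _) (norm_genOp_le hV y)
  refine (norm_inner_le_norm (𝕜 := ℂ) ψ _).trans ?_
  rw [hψ, one_mul]
  refine (ContinuousLinearMap.le_opNorm _ _).trans ?_
  rw [hψ, mul_one]
  exact h1.trans h2

end Bounded

/-! ### Embezzlement of the maximally entangled vector -/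

section Embezzling

/-- Schmidt weights of an embezzling vector: the vertex `k + 1` of the rooted `d`-ary tree on `ℕ` is
a child of the vertex `k / d`, and carries its weight divided by `√d`. -/
noncomputable def treeWeight (d : ℕ) : ℕ → ℝ
  | 0 => 1
  | k + 1 => treeWeight d (k / d) / √(d : ℝ)
decreasing_by exact Nat.lt_succ_of_le (Nat.div_le_self k d)

lemma treeWeight_zero (d : ℕ) : treeWeight d 0 = 1 := by rw [treeWeight]

lemma treeWeight_succ (d k : ℕ) : treeWeight d (k + 1) = treeWeight d (k / d) / √(d : ℝ) := by
  rw [treeWeight]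

lemma treeWeight_mem_Icc {d : ℕ} (hd : 1 ≤ d) (k : ℕ) :
    0 ≤ treeWeight d k ∧ treeWeight d k ≤ 1 := by
  induction k using Nat.strong_induction_on with
  | _ k ih =>
    cases k with
    | zero => simp [treeWeight_zero]
    | succ k =>
      obtain ⟨h0, h1⟩ := ih (k / d) (Nat.lt_succ_of_le (Nat.div_le_self k d))
      have : 1 ≤ √(d : ℝ) := Real.one_le_sqrt.2 (by exact_mod_cast hd)
      rw [treeWeight_succ]
      exact ⟨by positivity, div_le_one_of_le₀ (h1.trans this) (by positivity)⟩

lemma sum_range_mul_divMod {R : Type*} [AddCommMonoid R] {d : ℕ} (hd : 1 ≤ d) (L : ℕ)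
    (h : ℕ → ℕ → R) :
    ∑ k ∈ Finset.range (L * d), h (k / d) (k % d) =
      ∑ q ∈ Finset.range L, ∑ r ∈ Finset.range d, h q r := by
  induction L with
  | zero => simp
  | succ L ih =>
    rw [Nat.succ_mul, Finset.sum_range_add, ih, Finset.sum_range_succ]
    congr 1
    refine Finset.sum_congr rfl fun r hr => ?_
    have hr := Finset.mem_range.1 hr
    rw [mul_comm L d, Nat.mul_add_div (by omega), Nat.div_eq_of_lt hr, Nat.mul_add_mod,
      Nat.mod_eq_of_lt hr, add_zero]

/-- The squared norm of the embezzling vector on the first `N` vertices. -/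
noncomputable def treeMass (d N : ℕ) : ℝ := ∑ k ∈ Finset.range N, treeWeight d k ^ 2

/-- The first L * d + 1 vertices are the root and all children of the first L vertices. The d
children of a vertex together carry its squared weight, and the root adds 1. -/
lemma treeMass_mul_add_one {d : ℕ} (hd : 1 ≤ d) (L : ℕ) :
    treeMass d (L * d + 1) = treeMass d L + 1 := by
  have hd' : (d : ℝ) ≠ 0 := by positivity
  rw [treeMass, Finset.sum_range_succ', treeWeight_zero]
  simp only [treeWeight_succ, div_pow, Real.sq_sqrt (Nat.cast_nonneg d)]
  rw [sum_range_mul_divMod hd L fun q _ => treeWeight d q ^ 2 / d]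
  simp [treeMass, mul_div_cancel₀ _ hd']

lemma exists_treeMass_eq {d : ℕ} (hd : 1 ≤ d) (t : ℕ) :
    ∃ L, treeMass d (L * d + 1) = t + 1 := by
  induction t with
  | zero => exact ⟨0, by simp [treeMass, treeWeight_zero]⟩
  | succ t ih =>
    obtain ⟨L, hL⟩ := ih
    exact ⟨L * d + 1, by rw [treeMass_mul_add_one hd, hL]; push_cast; ring⟩

variable {ι : Type v} [Fintype ι] [DecidableEq ι]

/-- Parent and birth order k / d, k % d determine k, so the prescription is injective on the
non-root vertices of the first column; on a finite set it extends to a permutation, in an arbitrary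
way. -/
lemma exists_perm_divMod {n d L : ℕ} (hd : 1 ≤ d) (hdn : d ≤ n) (e : ι ≃ Fin (L * d + 1)) :
    ∃ σ : Equiv.Perm (Fin n × ι), ∀ (j : Fin n) (k : Fin (L * d)), (j : ℕ) = 0 →
      σ (j, e.symm k.succ) = (⟨k % d, (Nat.mod_lt _ hd).trans_le hdn⟩,
        e.symm ⟨k / d, Nat.lt_succ_of_le ((Nat.div_le_self _ _).trans k.2.le)⟩) := by
  -- Subtracting 1 undoes the shift of non-root labels. At the root the truncated value is
  -- meaningless, and `s` leaves the root out.
  let f : Fin n × ι → Fin n × ι := fun p =>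
    (⟨((e p.2 : ℕ) - 1) % d, (Nat.mod_lt _ hd).trans_le hdn⟩,
      e.symm ⟨((e p.2 : ℕ) - 1) / d, (Nat.div_le_self _ _).trans_lt (by omega)⟩)
  let s : Finset (Fin n × ι) := {p | (p.1 : ℕ) = 0 ∧ (e p.2 : ℕ) ≠ 0}
  have hinj : Set.InjOn f s := by
    rintro ⟨j, a⟩ hp ⟨j', a'⟩ hp' h
    simp only [s, Finset.coe_filter, Finset.mem_univ, true_and, Set.mem_ofPred_eq] at hp hp'
    simp only [f, Prod.mk.injEq, Fin.mk.injEq, EmbeddingLike.apply_eq_iff_eq] at h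
    have h3 : (e a : ℕ) - 1 = (e a' : ℕ) - 1 := by
      rw [← Nat.div_add_mod ((e a : ℕ) - 1) d, h.1, h.2, Nat.div_add_mod]
    refine Prod.ext (Fin.ext (hp.1.trans hp'.1.symm)) (e.injective (Fin.ext ?_))
    have h4 : (e a : ℕ) ≠ 0 := hp.2
    have h5 : (e a' : ℕ) ≠ 0 := hp'.2
    change (e a : ℕ) = e a'
    omega
  obtain ⟨g, hg⟩ := Finset.exists_equiv_extend_of_card_eq (t := Finset.univ)
    (Finset.card_univ (α := Fin n × ι)).symm (Finset.subset_univ (s.image f)) hinj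
  refine ⟨g.trans (Equiv.subtypeUnivEquiv Finset.mem_univ), fun j k hj => ?_⟩
  have := hg (j, e.symm k.succ) (by simp [s, hj])
  refine this.trans ?_
  simp [f]

/-- Each basis index b has a single image under σ, so the double sum collapses; a term survives only
if σ and τ agree on the new basis index. -/
lemma sum_permUnitary_mul {n m : ℕ} (σ : Equiv.Perm (Fin n × ι)) (τ : Equiv.Perm (Fin m × ι))
    (w : ι → ℂ) (i j : Fin n) (k l : Fin m) :
    ∑ a, ∑ b, w a * w b * (permUnitary σ i j a b * permUnitary τ k l a b) =
      ∑ b, w (σ (j, b)).2 * w b *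
        if (σ (j, b)).1 = i ∧ τ (l, b) = (k, (σ (j, b)).2) then 1 else 0 := by
  rw [Finset.sum_comm]
  refine Finset.sum_congr rfl fun b _ => ?_
  rw [Finset.sum_eq_single (σ (j, b)).2]
  · simp only [permUnitary, Prod.ext_iff (x := σ (j, b)), and_true, ite_and, ite_mul, one_mul,
      zero_mul]
  · intro a _ ha
    have : σ (j, b) ≠ (i, a) := fun h => ha (by rw [h])
    simp [permUnitary, this]
  · simp

/-- The first columns of unitaries in finite dimension embezzle the maximally entangled vector
up to an arbitrarily small error. -/
lemma exists_mem_UCq_norm_sub_le {n m : ℕ} (hn : 1 ≤ n) (hm : 1 ≤ m) (t : ℕ) :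
    ∃ c ∈ UCq.{v} n m, ∀ (i j : Fin n) (k l : Fin m), (j : ℕ) = 0 → (l : ℕ) = 0 →
      ‖c (.entry i j) (.entry k l) - maxEntangledCoeff n m i k‖ ≤ 2 * (1 / ((t : ℝ) + 1)) := by
  set d := min n m
  have hd : 1 ≤ d := le_min hn hm
  obtain ⟨L, hL⟩ := exists_treeMass_eq hd t
  let e : ULift.{v} (Fin (L * d + 1)) ≃ Fin (L * d + 1) := Equiv.ulift
  obtain ⟨σ, hσ⟩ := exists_perm_divMod hd (min_le_left n m) e
  obtain ⟨τ, hτ⟩ := exists_perm_divMod hd (min_le_right n m) e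
  set S : ℝ := (t : ℝ) + 1 with hS_def
  have hS : 0 < S := by positivity
  have hsd : 1 ≤ √(d : ℝ) := Real.one_le_sqrt.2 (by exact_mod_cast hd)
  let w : ULift.{v} (Fin (L * d + 1)) → ℝ := fun a => treeWeight d (e a) / √S
  have hw : ∑ a, w a ^ 2 = 1 := by
    rw [Fintype.sum_equiv e (fun a => w a ^ 2) (fun k => treeWeight d k ^ 2 / S)
      (fun a => by simp only [w, div_pow, Real.sq_sqrt hS.le]),
      Fin.sum_univ_eq_sum_range (fun k => treeWeight d k ^ 2 / S), ← Finset.sum_div]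
    change treeMass d (L * d + 1) / S = 1
    rw [hL, div_self hS.ne']
  have hww (a b) : ‖(w a : ℂ) * w b‖ ≤ 1 / S := by
    obtain ⟨ha0, ha1⟩ := treeWeight_mem_Icc hd (e a)
    obtain ⟨hb0, hb1⟩ := treeWeight_mem_Icc hd (e b)
    rw [← Complex.ofReal_mul, Complex.norm_real, Real.norm_eq_abs, abs_of_nonneg (by positivity),
      div_mul_div_comm, Real.mul_self_sqrt hS.le]
    gcongr
    exact mul_le_one₀ ha1 hb0 hb1
  refine ⟨_, mem_UCq_of_diagVec hw (permUnitary_mem_unitary σ) (permUnitary_mem_unitary τ),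
    fun i j k l hj hl => ?_⟩
  simp only [genElt]
  rw [sum_permUnitary_mul σ τ (fun a => (w a : ℂ)), ← e.symm.sum_comp, Fin.sum_univ_succ]
  -- The root has no parent, so its image is uncontrolled, but it contributes one term, of modulus
  -- at most 1 / S.
  set R := (w (σ (j, e.symm 0)).2 : ℂ) * (w (e.symm 0) : ℂ) *
        if (σ (j, e.symm 0)).1 = i ∧ τ (l, e.symm 0) = (k, (σ (j, e.symm 0)).2) then 1 else 0
  have hR : ‖R‖ ≤ 1 / S := by
    simp only [R]
    split_ifs
    · simpa using hww _ _
    · simpa using hS.le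
  -- The contribution of the r-th child of q: the weight of q times that of its child, present only
  -- when r is both i and k.
  let G : ℕ → ℕ → ℂ := fun q r => ((treeWeight d q ^ 2 / (S * √(d : ℝ)) : ℝ) : ℂ) *
    if r = (i : ℕ) ∧ r = (k : ℕ) then 1 else 0
  have hterm (k' : Fin (L * d)) : (w (σ (j, e.symm k'.succ)).2 : ℂ) * (w (e.symm k'.succ) : ℂ) *
      (if (σ (j, e.symm k'.succ)).1 = i ∧
        τ (l, e.symm k'.succ) = (k, (σ (j, e.symm k'.succ)).2) then 1 else 0) =
      G (k' / d) (k' % d) := by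
    have hval : w (e.symm ⟨k' / d, Nat.lt_succ_of_le ((Nat.div_le_self _ _).trans k'.2.le)⟩) *
        w (e.symm k'.succ) = treeWeight d (k' / d) ^ 2 / (S * √(d : ℝ)) := by
      simp only [w, Equiv.apply_symm_apply, Fin.val_succ, treeWeight_succ]
      field_simp
      rw [Real.sq_sqrt hS.le]
    rw [hσ j k' hj, hτ l k' hl, ← Complex.ofReal_mul, hval]
    simp only [G, Prod.mk.injEq, and_true, Fin.ext_iff]
  have hmass : treeMass d L = S - 1 := by
    rw [← hL, treeMass_mul_add_one hd]; ring
  -- Only the L vertices whose children are present contribute. Their mass is S - 1, so the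
  -- coefficient is missed by the proportion 1 / S, the second half of the error.
  have hsum : ∑ q ∈ Finset.range L, ∑ r ∈ Finset.range d, G q r =
      (((S - 1) / S : ℝ) : ℂ) * maxEntangledCoeff n m i k := by
    have hin : ∑ r ∈ Finset.range d, (if r = (i : ℕ) ∧ r = (k : ℕ) then (1 : ℂ) else 0) =
        if (i : ℕ) = k then 1 else 0 := by
      have hi : (i : ℕ) = k → (i : ℕ) < d := fun h => lt_min i.2 (h ▸ k.2)
      simp only [ite_and, Finset.sum_ite_eq', Finset.mem_range]
      split_ifs <;> simp_all
    simp only [G, ← Finset.mul_sum, hin, ← Finset.sum_mul, ← Complex.ofReal_sum, ← Finset.sum_div]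
    change ((treeMass d L / _ : ℝ) : ℂ) * _ = _
    rw [hmass, maxEntangledCoeff, mul_ite, mul_ite, mul_zero, mul_zero, mul_one,
      ← Complex.ofReal_mul, div_mul_div_comm, mul_one]
  have hcoeff : ‖maxEntangledCoeff n m i k‖ ≤ 1 := by
    rw [maxEntangledCoeff]
    split_ifs
    · rw [Complex.norm_real, Real.norm_of_nonneg (by positivity)]
      exact div_le_one_of_le₀ hsd (by positivity)
    · simp
  rw [Fintype.sum_congr _ _ hterm, Fin.sum_univ_eq_sum_range fun k' => G (k' / d) (k' % d),
    sum_range_mul_divMod hd L G, hsum]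
  have hS' : (((S - 1) / S : ℝ) : ℂ) = 1 - ((1 / S : ℝ) : ℂ) := by
    rw [sub_div, div_self hS.ne', Complex.ofReal_sub, Complex.ofReal_one]
  rw [hS', show R + (1 - ((1 / S : ℝ) : ℂ)) * maxEntangledCoeff n m i k - maxEntangledCoeff n m i k =
    R - ((1 / S : ℝ) : ℂ) * maxEntangledCoeff n m i k by ring, two_mul]
  refine (norm_sub_le _ _).trans (add_le_add hR ?_)
  rw [norm_mul, Complex.norm_real, Real.norm_of_nonneg (by positivity)]
  exact mul_le_of_le_one_right (by positivity) hcoeff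

lemma exists_mem_closure_UCq_embezzles {n m : ℕ} (hn : 1 ≤ n) (hm : 1 ≤ m) :
    ∃ c ∈ closure (UCq.{v} n m), EmbezzlesMaxEntangled c := by
  choose c hc h using exists_mem_UCq_norm_sub_le.{v} hn hm
  obtain ⟨c₀, hc₀, φ, hφ, hlim⟩ :=
    (isCompact_closure_UCq n m).tendsto_subseq fun t => subset_closure (hc t)
  refine ⟨c₀, hc₀, fun i j k l hj hl => ?_⟩
  have h1 : Filter.Tendsto (fun t => c (φ t) (.entry i j) (.entry k l)) Filter.atTop
      (nhds (c₀ (.entry i j) (.entry k l))) :=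
    ((continuous_apply_apply _ _).tendsto c₀).comp hlim
  refine tendsto_nhds_unique h1 ?_
  rw [tendsto_iff_norm_sub_tendsto_zero]
  have h2 : Filter.Tendsto (fun t => 2 * (1 / ((φ t : ℝ) + 1))) Filter.atTop (nhds 0) := by
    simpa using ((tendsto_one_div_add_atTop_nhds_zero_nat (𝕜 := ℝ)).comp
      hφ.tendsto_atTop).const_mul 2
  exact squeeze_zero (fun _ => norm_nonneg _) (fun t => h (φ t) i j k l hj hl) h2

end Embezzling

/-! ### The projective norm of the maximally entangled vector -/

section ProjectiveNorm

lemma sum_sum_ite_val_eq {M : Type*} [AddCommMonoid M] (n m : ℕ) (g : Fin n → Fin m → M) :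
    ∑ i : Fin n, ∑ k : Fin m, (if (i : ℕ) = (k : ℕ) then g i k else 0) = ∑ i : Fin (min n m),
      g (Fin.castLE (min_le_left n m) i) (Fin.castLE (min_le_right n m) i) := by
  rw [← Fintype.sum_prod_type']
  refine (Fintype.sum_of_injective
    (fun i : Fin (min n m) => (Fin.castLE (min_le_left n m) i, Fin.castLE (min_le_right n m) i))
    (fun i i' h => Fin.castLE_injective (min_le_left n m) (Prod.ext_iff.1 h).1) _ _ ?_ fun i => ?_).symm
  · rintro ⟨i, k⟩ h
    refine if_neg fun (hik : (i : ℕ) = k) => h ⟨⟨i, lt_min i.2 (hik ▸ k.2)⟩, Prod.ext rfl (Fin.ext hik)⟩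
  · simp

lemma maxEntangled_eq (n m : ℕ) : maxEntangled n m = ∑ i : Fin (min n m),
    ((1 / √((min n m : ℕ) : ℝ) : ℝ) : ℂ) •
      EuclideanSpace.single (Fin.castLE (min_le_left n m) i) (1 : ℂ) ⊗ₜ[ℂ]
      EuclideanSpace.single (Fin.castLE (min_le_right n m) i) (1 : ℂ) := by
  rw [maxEntangled, ← sum_sum_ite_val_eq n m fun i k => ((1 / √((min n m : ℕ) : ℝ) : ℝ) : ℂ) •
    EuclideanSpace.single i (1 : ℂ) ⊗ₜ[ℂ] EuclideanSpace.single k (1 : ℂ)]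
  refine Finset.sum_congr rfl fun i _ => Finset.sum_congr rfl fun k _ => ?_
  rw [maxEntangledCoeff]
  split_ifs <;> simp [TensorProduct.smul_tmul']

/-- The bilinear form `∑ x i * y i` over the common coordinates. -/
noncomputable def commonDot (n m : ℕ) :
    EuclideanSpace ℂ (Fin n) →ₗ[ℂ] EuclideanSpace ℂ (Fin m) →ₗ[ℂ] ℂ :=
  LinearMap.mk₂ ℂ (fun x y => ∑ i : Fin (min n m),
      x (Fin.castLE (min_le_left n m) i) * y (Fin.castLE (min_le_right n m) i))
    (fun x x' y => by simp [add_mul, Finset.sum_add_distrib])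
    (fun r x y => by simp [mul_assoc, Finset.mul_sum])
    (fun x y y' => by simp [mul_add, Finset.sum_add_distrib])
    (fun r x y => by simp [mul_left_comm, Finset.mul_sum])

lemma norm_commonDot_le {n m : ℕ} (x : EuclideanSpace ℂ (Fin n)) (y : EuclideanSpace ℂ (Fin m)) :
    ‖commonDot n m x y‖ ≤ ‖x‖ * ‖y‖ := by
  have hle {k : ℕ} (z : EuclideanSpace ℂ (Fin k)) {a : Fin (min n m) → Fin k}
      (ha : a.Injective) : ∑ i, ‖z (a i)‖ ^ 2 ≤ ‖z‖ ^ 2 := by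
    rw [EuclideanSpace.norm_sq_eq, ← Finset.sum_image (f := fun i => ‖z i‖ ^ 2) ha.injOn]
    exact Finset.sum_le_univ_sum_of_nonneg fun _ => by positivity
  rw [commonDot, LinearMap.mk₂_apply]
  refine (norm_sum_le _ _).trans ?_
  simp only [norm_mul]
  refine (Real.sum_mul_le_sqrt_mul_sqrt _ _ _).trans ?_
  gcongr
  · exact Real.sqrt_le_iff.2 ⟨norm_nonneg _, hle x (Fin.castLE_injective _)⟩
  · exact Real.sqrt_le_iff.2 ⟨norm_nonneg _, hle y (Fin.castLE_injective _)⟩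

/-- The defining expansion has d terms of size 1 / √d, which gives the upper bound. For the lower
bound, `commonDot` is contractive and takes the value √d on this vector, so no representation can
cost less. -/
lemma projectiveNorm_maxEntangled {n m : ℕ} :
    projectiveNorm (maxEntangled n m) = √((min n m : ℕ) : ℝ) := by
  have hmem : √((min n m : ℕ) : ℝ) ∈ {r : ℝ | ∃ (k : ℕ) (x : Fin k → EuclideanSpace ℂ (Fin n))
      (y : Fin k → EuclideanSpace ℂ (Fin m)),
      maxEntangled n m = ∑ i, x i ⊗ₜ[ℂ] y i ∧ r = ∑ i, ‖x i‖ * ‖y i‖} := by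
    refine ⟨_, _, _, maxEntangled_eq n m, ?_⟩
    simp only [norm_smul, Complex.norm_real, PiLp.norm_single, norm_one, mul_one,
      Finset.sum_const, Finset.card_univ, Fintype.card_fin, nsmul_eq_mul]
    rw [Real.norm_of_nonneg (by positivity), mul_one_div, Real.div_sqrt]
  refine IsLeast.csInf_eq ⟨hmem, ?_⟩
  rintro r ⟨k, x, y, h, rfl⟩
  have h1 : TensorProduct.lift (commonDot n m) (maxEntangled n m) =
      ((√((min n m : ℕ) : ℝ) : ℝ) : ℂ) := by
    have hdot (i : Fin (min n m)) : commonDot n m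
        (EuclideanSpace.single (Fin.castLE (min_le_left n m) i) 1)
        (EuclideanSpace.single (Fin.castLE (min_le_right n m) i) 1) = 1 := by
      simp [commonDot]
    rw [maxEntangled_eq, map_sum]
    simp only [TensorProduct.lift.tmul, map_smul, hdot, smul_eq_mul, mul_one,
      Finset.sum_const, Finset.card_univ, Fintype.card_fin, nsmul_eq_mul]
    rw [← Complex.ofReal_natCast, ← Complex.ofReal_mul, mul_one_div, Real.div_sqrt]
  have h2 : TensorProduct.lift (commonDot n m) (maxEntangled n m) =
      ∑ i, commonDot n m (x i) (y i) := by
    rw [h]; simp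
  calc √((min n m : ℕ) : ℝ) = ‖((√((min n m : ℕ) : ℝ) : ℝ) : ℂ)‖ := by
        rw [Complex.norm_real, Real.norm_of_nonneg (Real.sqrt_nonneg _)]
    _ ≤ ∑ i, ‖commonDot n m (x i) (y i)‖ := by
        rw [← h1, h2]; exact norm_sum_le _ _
    _ ≤ _ := Finset.sum_le_sum fun i _ => norm_commonDot_le _ _

end ProjectiveNorm

end UnitaryCorrelation

theorem mainTheorem12 (n m : ℕ) (hn : 2 ≤ n) (hm : 2 ≤ m) :
    UnitaryCorrelation.UCloc.{u} n m ⊂ UnitaryCorrelation.UCq.{v} n m ∧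
    UnitaryCorrelation.projectiveNorm (UnitaryCorrelation.maxEntangled n m) =
      √((min n m : ℕ) : ℝ) ∧
    1 < √((min n m : ℕ) : ℝ) ∧
    (∃ c ∈ closure (UnitaryCorrelation.UCq.{v} n m),
      UnitaryCorrelation.EmbezzlesMaxEntangled c) ∧
    (∀ c ∈ closure (UnitaryCorrelation.UCloc.{u} n m),
      ¬ UnitaryCorrelation.EmbezzlesMaxEntangled c) := by
  have hq : ∃ c ∈ closure (UnitaryCorrelation.UCq.{v} n m),
      UnitaryCorrelation.EmbezzlesMaxEntangled c :=
    UnitaryCorrelation.exists_mem_closure_UCq_embezzles (by omega) (by omega)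
  have hloc : ∀ c ∈ closure (UnitaryCorrelation.UCloc.{u} n m),
      ¬ UnitaryCorrelation.EmbezzlesMaxEntangled c := fun c hc =>
    UnitaryCorrelation.not_embezzles_of_mem_convexHull hn hm
      (closure_minimal (UnitaryCorrelation.UCloc_subset_convexHull n m)
        (UnitaryCorrelation.isCompact_convexHull_productCorrelations n m).isClosed hc)
  refine ⟨⟨(UnitaryCorrelation.UCloc_subset_convexHull n m).trans
    (UnitaryCorrelation.convexHull_subset_UCq n m), fun hsub => ?_⟩,
    UnitaryCorrelation.projectiveNorm_maxEntangled, ?_, hq, hloc⟩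
  -- The embezzling point is only known to lie in the closure of `UCq`, so the assumed reverse
  -- inclusion is passed to closures.
  · obtain ⟨c, hc, he⟩ := hq
    exact hloc c (closure_mono hsub hc) he
  · have : (2 : ℝ) ≤ (min n m : ℕ) := by exact_mod_cast le_min hn hm
    exact Real.lt_sqrt_of_sq_lt (by linarith)
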